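/- Let $K$ be a field of characteristic different from $2$, let $\bar K$ be its algebraic closure, let $n\ge 7$ be an integer, and let $h(x)\in K[x]$ be an irreducible polynomial of degree $n-1$ whose Galois group over $K$ is the full symmetric group $\mathbf S_{n-1}$ or the alternating group $\mathbf A_{n-1}$. For $t\in K$ let $D(t)$ be the hyperelliptic curve $y^2=(x-t)h(x)$, that is, the smooth projective curve with this affine equation. Then there exists a finite set $B=B(h)\subset K$ such that, whenever $t_1$ and $t_2$ are distinct elements of $K$ for which $D(t_1)$ and $D(t_2)$ are isomorphic over $\bar K$, both $t_1$ and $t_2$ belong to $B$. -/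

import Mathlib

open CategoryTheory CategoryTheory.Limits AlgebraicGeometry
open scoped Polynomial

noncomputable section

namespace Hyperelliptic

universe u

/-- The coordinate ring `k[x, y] / (y² - f(x))` of the affine plane curve `y² = f(x)`. -/
abbrev CoordRing {k : Type u} [Field k] (f : k[X]) : Type u :=
  AdjoinRoot (Polynomial.X ^ 2 - Polynomial.C f : (k[X])[X])

/-- The class of `x` in `k[x, y] / (y² - f(x))`. -/
def xCoord {k : Type u} [Field k] (f : k[X]) : CoordRing f :=
  AdjoinRoot.of _ Polynomial.X

/-- The class of `y` in `k[x, y] / (y² - f(x))`. -/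
def yCoord {k : Type u} [Field k] (f : k[X]) : CoordRing f :=
  AdjoinRoot.root _

/-- The ring of functions on the locus `x ≠ 0` of the affine curve `y² = f(x)`. -/
abbrev AwayRing {k : Type u} [Field k] (f : k[X]) : Type u :=
  Localization.Away (xCoord f)

/-- The function `x⁻¹` on the locus `x ≠ 0`. -/
def xInv {k : Type u} [Field k] (f : k[X]) : AwayRing f :=
  IsLocalization.Away.invSelf (xCoord f)

lemma mul_xInv {k : Type u} [Field k] (f : k[X]) :
    algebraMap (CoordRing f) (AwayRing f) (xCoord f) * xInv f = 1 :=
  IsLocalization.Away.mul_invSelf _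

lemma yCoord_sq {k : Type u} [Field k] (f : k[X]) :
    yCoord f ^ 2 = Polynomial.aeval (xCoord f) f := by
  have h := AdjoinRoot.eval₂_root (Polynomial.X ^ 2 - Polynomial.C f : (k[X])[X])
  rw [Polynomial.eval₂_sub, Polynomial.eval₂_pow, Polynomial.eval₂_X, Polynomial.eval₂_C,
    sub_eq_zero] at h
  have h2 : AdjoinRoot.ofAlgHom k (Polynomial.X ^ 2 - Polynomial.C f : (k[X])[X]) f =
      Polynomial.aeval (xCoord f) f := by
    exact DFunLike.congr_fun (Polynomial.algHom_ext (by simp [xCoord]) :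
      AdjoinRoot.ofAlgHom k (Polynomial.X ^ 2 - Polynomial.C f : (k[X])[X]) =
        Polynomial.aeval (xCoord f)) f
  exact h.trans h2

/-- With `g(u) = u^(2m) f(1/u)`, the functions `u = x⁻¹` and `v = y x⁻ᵐ` satisfy `v² = g(u)`. -/
lemma chart_relation {k : Type u} [Field k] (m : ℕ) (f g : k[X])
    (hf : f.natDegree ≤ 2 * m) (hfg : g = f.reflect (2 * m)) :
    Polynomial.eval₂ (Polynomial.aeval (xInv f) : k[X] →ₐ[k] AwayRing f)
      (algebraMap (CoordRing f) (AwayRing f) (yCoord f) * xInv f ^ m)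
      (Polynomial.X ^ 2 - Polynomial.C g : (k[X])[X]) = 0 := by
  let _ : Invertible (algebraMap (CoordRing f) (AwayRing f) (xCoord f)) :=
    ⟨xInv f, by rw [mul_comm]; exact mul_xInv f, mul_xInv f⟩
  have key := Polynomial.eval₂_reflect_mul_pow (algebraMap k (AwayRing f))
    (algebraMap (CoordRing f) (AwayRing f) (xCoord f)) (2 * m) f hf
  change Polynomial.eval₂ _ (xInv f) _ * _ = _ at key
  have hy : algebraMap (CoordRing f) (AwayRing f) (yCoord f) ^ 2 =
      Polynomial.eval₂ (algebraMap k (AwayRing f))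
        (algebraMap (CoordRing f) (AwayRing f) (xCoord f)) f := by
    rw [← map_pow, yCoord_sq, ← Polynomial.aeval_algebraMap_apply, Polynomial.aeval_def]
  rw [Polynomial.eval₂_sub, Polynomial.eval₂_pow, Polynomial.eval₂_X, Polynomial.eval₂_C,
    sub_eq_zero, mul_pow, hy, ← key, hfg, mul_assoc, ← pow_mul, mul_comm m 2, ← mul_pow,
    mul_xInv, one_pow, mul_one]
  rfl

/-- The change of charts `u ↦ x⁻¹`, `v ↦ y x⁻ᵐ`, from functions on `v² = g(u)`, where
`g(u) = u^(2m) f(1/u)`, to functions on the locus `x ≠ 0` of `y² = f(x)`. -/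
def chartMap {k : Type u} [Field k] (m : ℕ) (f g : k[X])
    (hf : f.natDegree ≤ 2 * m) (hfg : g = f.reflect (2 * m)) :
    CoordRing g →ₐ[k] AwayRing f :=
  AdjoinRoot.liftAlgHom _ (Polynomial.aeval (xInv f))
    (algebraMap (CoordRing f) (AwayRing f) (yCoord f) * xInv f ^ m)
    (chart_relation m f g hf hfg)

lemma chartMap_x {k : Type u} [Field k] (m : ℕ) (f g : k[X])
    (hf : f.natDegree ≤ 2 * m) (hfg : g = f.reflect (2 * m)) :
    chartMap m f g hf hfg (xCoord g) = xInv f := by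
  refine Eq.trans ?_ (Polynomial.aeval_X (R := k) (xInv f))
  exact AdjoinRoot.liftAlgHom_of _ (Polynomial.aeval (xInv f))
    (algebraMap (CoordRing f) (AwayRing f) (yCoord f) * xInv f ^ m)
    (chart_relation m f g hf hfg) Polynomial.X

lemma chartMap_y {k : Type u} [Field k] (m : ℕ) (f g : k[X])
    (hf : f.natDegree ≤ 2 * m) (hfg : g = f.reflect (2 * m)) :
    chartMap m f g hf hfg (yCoord g) =
      algebraMap (CoordRing f) (AwayRing f) (yCoord f) * xInv f ^ m := by
  simp [chartMap, yCoord]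

lemma isUnit_chartMap_x {k : Type u} [Field k] (m : ℕ) (f g : k[X])
    (hf : f.natDegree ≤ 2 * m) (hfg : g = f.reflect (2 * m)) :
    IsUnit (chartMap m f g hf hfg (xCoord g)) := by
  rw [chartMap_x]
  exact IsUnit.of_mul_eq_one _ (by rw [mul_comm]; exact mul_xInv f)

/-- The change of charts on the overlap, from functions on `u ≠ 0` to functions on `x ≠ 0`. -/
def overlapMap {k : Type u} [Field k] (m : ℕ) (f g : k[X])
    (hf : f.natDegree ≤ 2 * m) (hfg : g = f.reflect (2 * m)) :
    AwayRing g →ₐ[k] AwayRing f :=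
  IsLocalization.Away.liftAlgHom (xCoord g) (isUnit_chartMap_x m f g hf hfg)

lemma overlapMap_algebraMap {k : Type u} [Field k] (m : ℕ) (f g : k[X])
    (hf : f.natDegree ≤ 2 * m) (hfg : g = f.reflect (2 * m)) (a : CoordRing g) :
    overlapMap m f g hf hfg (algebraMap (CoordRing g) (AwayRing g) a) =
      chartMap m f g hf hfg a := by
  simp [overlapMap]

lemma overlapMap_xInv {k : Type u} [Field k] (m : ℕ) (f g : k[X])
    (hf : f.natDegree ≤ 2 * m) (hfg : g = f.reflect (2 * m)) :
    overlapMap m f g hf hfg (xInv g) = algebraMap (CoordRing f) (AwayRing f) (xCoord f) := by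
  have h := congrArg (overlapMap m f g hf hfg) (mul_xInv g)
  rw [map_mul, map_one, overlapMap_algebraMap, chartMap_x] at h
  calc overlapMap m f g hf hfg (xInv g)
      = (algebraMap (CoordRing f) (AwayRing f) (xCoord f) * xInv f) *
          overlapMap m f g hf hfg (xInv g) := by rw [mul_xInv, one_mul]
    _ = algebraMap (CoordRing f) (AwayRing f) (xCoord f) := by rw [mul_assoc, h, mul_one]

lemma overlapMap_comp {k : Type u} [Field k] (m : ℕ) (f g : k[X])
    (hf : f.natDegree ≤ 2 * m) (hfg : g = f.reflect (2 * m))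
    (hg : g.natDegree ≤ 2 * m) (hgf : f = g.reflect (2 * m)) :
    (overlapMap m f g hf hfg).comp (overlapMap m g f hg hgf) = AlgHom.id k (AwayRing f) := by
  apply Localization.algHom_ext
  apply AdjoinRoot.algHom_ext'
  · apply Polynomial.algHom_ext
    change overlapMap m f g hf hfg (overlapMap m g f hg hgf
      (algebraMap (CoordRing f) (AwayRing f) (xCoord f))) =
        algebraMap (CoordRing f) (AwayRing f) (xCoord f)
    rw [overlapMap_algebraMap, chartMap_x, overlapMap_xInv]
  · change overlapMap m f g hf hfg (overlapMap m g f hg hgf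
      (algebraMap (CoordRing f) (AwayRing f) (yCoord f))) =
        algebraMap (CoordRing f) (AwayRing f) (yCoord f)
    rw [overlapMap_algebraMap, chartMap_y, map_mul, map_pow, overlapMap_xInv,
      overlapMap_algebraMap, chartMap_y, mul_assoc, ← mul_pow, mul_comm (xInv f), mul_xInv,
      one_pow, mul_one]

/-- The isomorphism between the functions on `u ≠ 0` and the functions on `x ≠ 0`. -/
def overlapEquiv {k : Type u} [Field k] (m : ℕ) (f g : k[X])
    (hf : f.natDegree ≤ 2 * m) (hfg : g = f.reflect (2 * m))
    (hg : g.natDegree ≤ 2 * m) (hgf : f = g.reflect (2 * m)) :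
    AwayRing g ≃ₐ[k] AwayRing f :=
  AlgEquiv.ofAlgHom (overlapMap m f g hf hfg) (overlapMap m g f hg hgf)
    (overlapMap_comp m f g hf hfg hg hgf) (overlapMap_comp m g f hg hgf hf hfg)

/-- For `f` of degree `2g + 1` or `2g + 2` this is `g + 1`. -/
def halfDegree {k : Type u} [Field k] (f : k[X]) : ℕ := (f.natDegree + 1) / 2

/-- The polynomial `u^(2g+2) f(1/u)`, where `deg f` is `2g + 1` or `2g + 2`. -/
def reversed {k : Type u} [Field k] (f : k[X]) : k[X] := f.reflect (2 * halfDegree f)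

lemma natDegree_le {k : Type u} [Field k] (f : k[X]) : f.natDegree ≤ 2 * halfDegree f := by
  unfold halfDegree
  omega

lemma natDegree_reversed_le {k : Type u} [Field k] (f : k[X]) :
    (reversed f).natDegree ≤ 2 * halfDegree f :=
  Polynomial.natDegree_reflect_le.trans (max_le le_rfl (natDegree_le f))

/-- The inclusion of the overlap `x ≠ 0` into the affine chart `y² = f(x)`. -/
def toChart {k : Type u} [Field k] (f : k[X]) :
    Spec (CommRingCat.of (AwayRing f)) ⟶ Spec (CommRingCat.of (CoordRing f)) :=
  Spec.map (CommRingCat.ofHom (algebraMap (CoordRing f) (AwayRing f)))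

/-- The inclusion `u = x⁻¹`, `v = y x^(-g-1)` of the overlap `x ≠ 0` into the affine chart
at infinity `v² = u^(2g+2) f(1/u)`. -/
def toChartAtInfinity {k : Type u} [Field k] (f : k[X]) :
    Spec (CommRingCat.of (AwayRing f)) ⟶ Spec (CommRingCat.of (CoordRing (reversed f))) :=
  Spec.map (CommRingCat.ofHom
    (chartMap (halfDegree f) f (reversed f) (natDegree_le f) rfl).toRingHom)

instance isOpenImmersion_toChart {k : Type u} [Field k] (f : k[X]) :
    IsOpenImmersion (toChart f) := by
  unfold toChart
  infer_instance

instance isOpenImmersion_toChartAtInfinity {k : Type u} [Field k] (f : k[X]) :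
    IsOpenImmersion (toChartAtInfinity f) := by
  let e := overlapEquiv (halfDegree f) f (reversed f) (natDegree_le f) rfl
    (natDegree_reversed_le f) (by simp [reversed])
  have h : toChartAtInfinity f =
      Spec.map e.toRingEquiv.toCommRingCatIso.hom ≫ toChart (reversed f) := by
    unfold toChartAtInfinity toChart
    rw [← Spec.map_comp]
    congr 1
    apply CommRingCat.hom_ext
    apply RingHom.ext
    intro a
    exact (overlapMap_algebraMap (halfDegree f) f (reversed f) (natDegree_le f) rfl a).symm
  rw [h]
  infer_instance

lemma toChart_structure {k : Type u} [Field k] (f : k[X]) :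
    toChart f ≫ Spec.map (CommRingCat.ofHom (algebraMap k (CoordRing f))) =
      toChartAtInfinity f ≫
        Spec.map (CommRingCat.ofHom (algebraMap k (CoordRing (reversed f)))) := by
  unfold toChart toChartAtInfinity
  rw [← Spec.map_comp, ← Spec.map_comp]
  congr 1
  ext a
  exact ((chartMap (halfDegree f) f (reversed f) (natDegree_le f) rfl).commutes a).symm

/-- The projective curve with affine equation `y² = f(x)`, as a scheme over `k`. It is glued from
the affine curves `y² = f(x)` and `v² = u^(2g+2) f(1/u)`, where `deg f` is `2g + 1` or `2g + 2`,
along `x ≠ 0` and `u ≠ 0` by `u = x⁻¹`, `v = y x^(-g-1)`. If the characteristic of `k` is not `2`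
and `f` is a polynomial without multiple roots of degree at least `5`, it is the (smooth,
projective) hyperelliptic curve of genus `g`. -/
def curve {k : Type u} [Field k] (f : k[X]) : Over (Spec (CommRingCat.of k)) :=
  Over.mk (pushout.desc
    (Spec.map (CommRingCat.ofHom (algebraMap k (CoordRing f))))
    (Spec.map (CommRingCat.ofHom (algebraMap k (CoordRing (reversed f)))))
    (toChart_structure f) :
    pushout (toChart f) (toChartAtInfinity f) ⟶ Spec (CommRingCat.of k))

/-- The curves `y² = f₁(x)` and `y² = f₂(x)`, with `f₁, f₂ ∈ K[x]`, are isomorphic over the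
algebraic closure of `K`. -/
def IsomorphicOverClosure {K : Type u} [Field K] (f₁ f₂ : K[X]) : Prop :=
  Nonempty (curve (f₁.map (algebraMap K (AlgebraicClosure K))) ≅
    curve (f₂.map (algebraMap K (AlgebraicClosure K))))

end Hyperelliptic

end

/-!
Over `L = AlgebraicClosure K` an isomorphism `D(t₁) ≅ D(t₂)` induces an isomorphism of function
fields. Both function fields are then a single field `F` with two presentations
`F = L(x, y) = L(z, w)`, `y² = f₁(x)`, `w² = f₂(z)` (`exists_common_functionField`).

The subfield `L(x)` is determined by `F`, by an elementary form of the Castelnuovo-Severi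
inequality. Since `F` has degree `2` over `L(x)` and over `L(z)`, the pair `(x, z)` lies on a plane
curve `P = 0` of bidegree at most `(2, 2)`. If `z ∉ L(x)`, completing the square shows that the
discriminant of `P`, a polynomial in `x` of degree at most `4`, is a square times `f₁`; this is
impossible for a squarefree `f₁` of degree at least `5`. So `L(x) = L(z)`, the relation `P` can be
taken of bidegree `(1, 1)`, and `z` is a Möbius transform of `x` (`IsQuadraticPair.exists_moebius`).
Comparing `f₁(x)` with `f₂(z)` modulo squares, this Möbius transformation carries the branch
points of `D(t₁)` to those of `D(t₂)` (`exists_moebius_of_iso`).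

Let `R` be the set of the common branch points: the roots of `h`, and `∞` if `n` is odd. It has at
least `7` elements. A Möbius transformation is determined by its values at three points, so only
finitely many of them send three points of `R` into `R`. Let `γ` carry `R ∪ {t₁}` into `R ∪ {t₂}`.
If `γ t₁ ∈ R`, then `t₁` is one of finitely many points. Otherwise `γ t₁ = t₂` and `γ` preserves
`R`, and so does every conjugate of `γ` under `Gal(L/K)`, which also sends `t₁` to `t₂`. Two
different Möbius transformations coincide in at most two points, so either `t₁` is again one of
finitely many points or `γ` commutes with the Galois group. In the latter case the largeness of the
Galois group forces `γ` to fix every root of `h` that it does not send to `∞`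
(`exists_gal_fix_move`), so `γ` has three fixed points, is the identity, and `t₁ = t₂`
(`mem_exceptionalPoints`).
-/

noncomputable section

namespace Hyperelliptic

/-! ### Function fields of curves `y² = f(x)` -/

section FunctionField
open Polynomial IntermediateField
open scoped Polynomial.Bivariate

variable {L F : Type*} [Field L] [Field F] [Algebra L F]

/-- The elements `x` and `y` present the field `F` as the function field of `y² = f(x)`: `x` is
transcendental, `y² = f(x)`, and `1, y` is a basis of `F` over `L(x)`. -/
structure IsQuadraticPair (f : L[X]) (x y : F) : Prop where
  transcendental : Transcendental L x
  sq_eq : y ^ 2 = aeval x f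
  exists_eq_add_mul : ∀ a : F, ∃ u ∈ L⟮x⟯, ∃ v ∈ L⟮x⟯, a = u + v * y
  notMem : y ∉ L⟮x⟯

lemma exists_mul_aeval_eq {x u : F} (hu : u ∈ L⟮x⟯) :
    ∃ r s : L[X], aeval x s ≠ 0 ∧ u * aeval x s = aeval x r := by
  obtain ⟨r, s, rfl⟩ := (mem_adjoin_simple_iff L u).1 hu
  by_cases hs : aeval x s = 0
  · exact ⟨0, 1, by simp, by simp [hs]⟩
  · exact ⟨r, s, hs, div_mul_cancel₀ _ hs⟩

lemma aeval_mem_adjoin (x : F) (p : L[X]) : aeval x p ∈ L⟮x⟯ :=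
  (mem_adjoin_simple_iff L _).2 ⟨p, 1, by simp⟩

/-- If `G` is `f` up to a square of rational functions, with `f` squarefree, then it is `f` up to a
square of polynomials. -/
lemma _root_.Squarefree.exists_eq_sq_mul {f G s t : L[X]} (hf : Squarefree f) (ht : t ≠ 0)
    (h : G * t ^ 2 = s ^ 2 * f) : ∃ r : L[X], G = r ^ 2 * f := by
  obtain ⟨s', t', e, hrel, hs, ht'⟩ :=
    UniqueFactorizationMonoid.exists_reduced_factors' s t ht
  have he : e ≠ 0 := by
    rintro rfl
    exact ht (by rw [← ht', zero_mul])
  have h1 : G * t' ^ 2 = s' ^ 2 * f := by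
    rw [← hs, ← ht'] at h
    have : e ^ 2 * (G * t' ^ 2) = e ^ 2 * (s' ^ 2 * f) := by linear_combination h
    exact mul_left_cancel₀ (pow_ne_zero 2 he) this
  have hdvd : t' ^ 2 ∣ f := by
    have : t' ^ 2 ∣ s' ^ 2 * f := ⟨G, by rw [← h1, mul_comm]⟩
    exact (hrel.symm.pow (m := 2) (n := 2)).dvd_of_dvd_mul_left this
  have hu : IsUnit t' := hf t' (by rwa [← sq])
  obtain ⟨v, hv⟩ := hu.exists_left_inv
  refine ⟨v * s', ?_⟩
  linear_combination v ^ 2 * h1 - G * (v * t' + 1) * hv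

/-- The ideal of polynomials vanishing at `(x, z)`, with `x` transcendental, is generated by any
irreducible polynomial in it. This is Gauss's lemma: `P` remains irreducible over the fraction field
of `L[X]`, and has there a common root with `N`. -/
lemma dvd_of_aevalAeval_eq_zero {x z : F} (hx : Transcendental L x) {P N : L[X][Y]}
    (hP : Irreducible P) (hP0 : aevalAeval x z P = 0) (hN : aevalAeval x z N = 0) : P ∣ N := by
  have hinj : Function.Injective (aeval x : L[X] →ₐ[L] F) := transcendental_iff_injective.1 hx
  let φ : FractionRing L[X] →+* F :=
    IsFractionRing.lift (g := (aeval x : L[X] →ₐ[L] F).toRingHom) hinj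
  have hφ (p : L[X]) : φ (algebraMap _ _ p) = aeval x p :=
    IsFractionRing.lift_algebraMap (g := (aeval x : L[X] →ₐ[L] F).toRingHom) hinj p
  have hev (M : L[X][Y]) :
      eval₂ φ z (M.map (algebraMap L[X] (FractionRing L[X]))) = aevalAeval x z M := by
    rw [eval₂_map]
    induction M using Polynomial.induction_on' with
    | add p q hp hq => simp only [eval₂_add, map_add, hp, hq]
    | monomial n a =>
      rw [eval₂_monomial, RingHom.comp_apply, hφ]
      simp [← C_mul_X_pow_eq_monomial]
  have hdeg : P.natDegree ≠ 0 := by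
    intro h0
    obtain ⟨p, rfl⟩ := natDegree_eq_zero.1 h0
    have : aeval x p = 0 := by simpa using hP0
    rw [(map_eq_zero_iff _ hinj).1 this, C_0] at hP
    exact hP.ne_zero rfl
  have hprim := hP.isPrimitive hdeg
  have hirr := (hprim.irreducible_iff_irreducible_map_fraction_map (K := FractionRing L[X])).1 hP
  refine hprim.dvd_of_fraction_map_dvd_fraction_map (K := FractionRing L[X]) ?_
  refine (hirr.isCoprime_or_dvd _).resolve_left ?_
  rintro ⟨a, b, hab⟩
  have := congrArg (eval₂ φ z) hab
  rw [eval₂_add, eval₂_mul, eval₂_mul, hev, hev, hP0, hN] at this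
  simp at this

/-- If `z` has degree at most `d` over `L(x)` and `x` has degree at most `e` over `L(z)`, then `x`
and `z` satisfy a relation of bidegree at most `(e, d)`. -/
lemma exists_relation_natDegree_le {x z : F} (hx : Transcendental L x)
    {N Q : L[X][Y]} (hN0 : N ≠ 0) (hQ0 : Q ≠ 0)
    (hN : aevalAeval x z N = 0) (hQ : aevalAeval z x Q = 0) :
    ∃ P : L[X][Y], P ≠ 0 ∧ aevalAeval x z P = 0 ∧ P.natDegree ≤ N.natDegree ∧
      (Bivariate.swap P).natDegree ≤ Q.natDegree := by
  have : ∃ P : L[X][Y], Irreducible P ∧ aevalAeval x z P = 0 := by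
    by_contra! hcon
    induction N using UniqueFactorizationMonoid.induction_on_prime with
    | h₁ => exact hN0 rfl
    | h₂ a ha => exact (ha.map (aevalAeval x z)).ne_zero hN
    | h₃ a p ha hp ih =>
      rw [map_mul] at hN
      rcases mul_eq_zero.1 hN with h | h
      · exact hcon p hp.irreducible h
      · exact ih ha h
  obtain ⟨P, hP, hPz⟩ := this
  refine ⟨P, hP.ne_zero, hPz, natDegree_le_of_dvd (dvd_of_aevalAeval_eq_zero hx hP hPz hN) hN0, ?_⟩
  have h1 : P ∣ Bivariate.swap Q :=
    dvd_of_aevalAeval_eq_zero hx hP hPz (by rw [Bivariate.aevalAeval_swap, hQ])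
  have h2 : Bivariate.swap P ∣ Q := by
    have := map_dvd (Bivariate.swap (R := L)) h1
    rwa [Bivariate.swap_swap_apply] at this
  exact natDegree_le_of_dvd h2 hQ0

lemma exists_linear_relation {x z : F} (hz : z ∈ L⟮x⟯) :
    ∃ N : L[X][Y], N ≠ 0 ∧ N.natDegree ≤ 1 ∧ aevalAeval x z N = 0 := by
  obtain ⟨r, s, hs, h⟩ := exists_mul_aeval_eq hz
  refine ⟨C s * X - C r, fun h0 => ?_, by compute_degree, by simp [← h]; ring⟩
  have := congrArg (coeff · 1) h0
  simp [coeff_C] at this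
  simp [this] at hs

lemma IsQuadraticPair.exists_quadratic_relation {f : L[X]} {x y : F} (h : IsQuadraticPair f x y)
    (z : F) : ∃ N : L[X][Y], N ≠ 0 ∧ N.natDegree ≤ 2 ∧ aevalAeval x z N = 0 := by
  obtain ⟨u, hu, v, hv, rfl⟩ := h.exists_eq_add_mul z
  obtain ⟨r, s, hs, hrs⟩ := exists_mul_aeval_eq hu
  obtain ⟨p, q, hq, hpq⟩ := exists_mul_aeval_eq hv
  refine ⟨(C (s * q) * X - C (r * q)) ^ 2 - C (f * (p * s) ^ 2), fun h0 => ?_, by compute_degree,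
    ?_⟩
  · have h2 := congrArg (coeff · 2) h0
    have h3 : ((C (s * q) * X - C (r * q)) ^ 2 - C (f * (p * s) ^ 2) : L[X][Y]) =
      C ((s * q) ^ 2) * X ^ 2 + C (-2 * (s * q) * (r * q)) * X +
        C ((r * q) ^ 2 - (f * (p * s) ^ 2)) := by
      simp only [map_mul, map_pow, map_sub, map_neg, map_ofNat]
      ring
    rw [h3] at h2
    simp [-map_mul, -map_pow, -map_sub] at h2
    rcases h2 with h2 | h2 <;> simp [h2] at hs hq
  · simp only [map_sub, map_pow, map_mul, aevalAeval_C, aevalAeval_Y, ← h.sq_eq, ← hrs, ← hpq]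
    ring

lemma coeff_coeff_swap (P : L[X][Y]) (i j : ℕ) :
    ((Bivariate.swap P).coeff j).coeff i = (P.coeff i).coeff j := by
  induction P using Polynomial.induction_on' with
  | add p q hp hq => simp only [map_add, coeff_add, hp, hq]
  | monomial n a =>
    induction a using Polynomial.induction_on' with
    | add p q hp hq => simp only [map_add, coeff_add, hp, hq]
    | monomial m a =>
      rw [Bivariate.swap_monomial_monomial]
      simp only [coeff_monomial]
      split_ifs <;> simp_all [coeff_monomial]

lemma natDegree_coeff_le_natDegree_swap (P : L[X][Y]) (i : ℕ) :
    (P.coeff i).natDegree ≤ (Bivariate.swap P).natDegree := by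
  by_cases h : P.coeff i = 0
  · simp [h]
  · refine le_natDegree_of_ne_zero fun h0 => h ?_
    rw [← leadingCoeff_eq_zero, leadingCoeff, ← coeff_coeff_swap, h0, coeff_zero]

/-- An element of `F` outside `L(x)` whose square lies in `L(x)` is a multiple of `y` by an element
of `L(x)`, so its square is `f(x)` up to a square. -/
lemma IsQuadraticPair.exists_eq_sq_mul {f D : L[X]} {x y p q : F} (h : IsQuadraticPair f x y)
    (h2 : (2 : L) ≠ 0) (hf : Squarefree f) (hp : p ∈ L⟮x⟯) (hq : q ∈ L⟮x⟯) (hq0 : q ≠ 0)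
    (hD : (p + q * y) ^ 2 = aeval x D) : ∃ r : L[X], r ≠ 0 ∧ D = r ^ 2 * f := by
  have h2F : (2 : F) ≠ 0 := by
    rw [← map_ofNat (algebraMap L F) 2]
    exact (_root_.map_ne_zero _).2 h2
  have hinj : Function.Injective (aeval x : L[X] →ₐ[L] F) :=
    transcendental_iff_injective.1 h.transcendental
  have hy0 : y ≠ 0 := by
    rintro rfl
    exact h.notMem (zero_mem _)
  have hp0 : p = 0 := by
    by_contra hp0
    refine h.notMem ?_
    have : y = (aeval x D - p ^ 2 - q ^ 2 * aeval x f) / (2 * p * q) := by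
      rw [eq_div_iff (mul_ne_zero (mul_ne_zero h2F hp0) hq0), ← hD, ← h.sq_eq]
      ring
    rw [this]
    have h2m : (2 : F) ∈ L⟮x⟯ := ofNat_mem _ 2
    exact div_mem (sub_mem (sub_mem (aeval_mem_adjoin x D) (pow_mem hp 2))
      (mul_mem (pow_mem hq 2) (aeval_mem_adjoin x f))) (mul_mem (mul_mem h2m hp) hq)
  obtain ⟨r, s, hs, hrs⟩ := exists_mul_aeval_eq hq
  have hs0 : s ≠ 0 := by
    rintro rfl
    simp at hs
  obtain ⟨r', hr'⟩ := hf.exists_eq_sq_mul (G := D) (s := r) hs0 (hinj (by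
    simp only [map_mul, map_pow, ← hrs, ← hD, ← h.sq_eq, hp0]
    ring))
  refine ⟨r', ?_, hr'⟩
  rintro rfl
  rw [hr', hp0] at hD
  simp [hq0, hy0] at hD

/-- If `x ∉ L(z)` then `F` is generated by `x` over `L(z)`, so `z ∈ L(x)` would give `F = L(x)`. -/
lemma IsQuadraticPair.mem_adjoin_of_mem {f g : L[X]} {x y z w : F} (h : IsQuadraticPair f x y)
    (h' : IsQuadraticPair g z w) (hz : z ∈ L⟮x⟯) : x ∈ L⟮z⟯ := by
  have hle : L⟮z⟯ ≤ L⟮x⟯ := by simpa using hz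
  obtain ⟨u, hu, v, hv, hx⟩ := h'.exists_eq_add_mul x
  by_cases hv0 : v = 0
  · rw [hx, hv0, zero_mul, add_zero]
    exact hu
  have hw : w ∈ L⟮x⟯ := by
    have : w = (x - u) / v := by
      rw [eq_div_iff hv0, hx]
      ring
    rw [this]
    exact div_mem (sub_mem (mem_adjoin_simple_self L x) (hle hu)) (hle hv)
  obtain ⟨p, hp, q, hq, hy⟩ := h'.exists_eq_add_mul y
  exact absurd (hy ▸ add_mem (hle hp) (mul_mem (hle hq) hw)) h.notMem

/-- The subfield `L(x)` contains every `z` over which `F` is quadratic: otherwise `F = L(x, z)`, and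
the discriminant of the relation of bidegree `(2, 2)` between `x` and `z` has degree at most `4`,
but is equal to `f` up to a square. -/
lemma IsQuadraticPair.mem_adjoin {f g : L[X]} {x y z w : F} (h : IsQuadraticPair f x y)
    (h' : IsQuadraticPair g z w) (h2 : (2 : L) ≠ 0) (hf : Squarefree f) (hdeg : 5 ≤ f.natDegree) :
    z ∈ L⟮x⟯ := by
  by_contra hz
  obtain ⟨N, hN0, hN, hNz⟩ := h.exists_quadratic_relation z
  obtain ⟨Q, hQ0, hQ, hQz⟩ := h'.exists_quadratic_relation x
  obtain ⟨P, hP0, hPz, hPN, hPQ⟩ := exists_relation_natDegree_le h.transcendental hN0 hQ0 hNz hQz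
  have hcoeff (i : ℕ) : (P.coeff i).natDegree ≤ 2 :=
    (natDegree_coeff_le_natDegree_swap P i).trans (hPQ.trans hQ)
  have hsum : P = C (P.coeff 0) + C (P.coeff 1) * Y + C (P.coeff 2) * Y ^ 2 := by
    conv_lhs => rw [as_sum_range_C_mul_X_pow' P (Nat.lt_succ_of_le (hPN.trans hN))]
    simp [Finset.sum_range_succ]
  obtain ⟨a, ha⟩ : ∃ a, a = P.coeff 2 := ⟨_, rfl⟩
  obtain ⟨b, hb⟩ : ∃ b, b = P.coeff 1 := ⟨_, rfl⟩
  obtain ⟨c, hc⟩ : ∃ c, c = P.coeff 0 := ⟨_, rfl⟩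
  have ha2 := ha ▸ hcoeff 2
  have hb2 := hb ▸ hcoeff 1
  have hc2 := hc ▸ hcoeff 0
  rw [← ha, ← hb, ← hc] at hsum
  have hrel : aeval x a * z ^ 2 + aeval x b * z + aeval x c = 0 := by
    rw [← hPz, hsum]
    simp only [map_add, map_mul, map_pow, aevalAeval_C, aevalAeval_Y]
    ring
  have hinj : Function.Injective (aeval x : L[X] →ₐ[L] F) :=
    transcendental_iff_injective.1 h.transcendental
  have ha0 : aeval x a ≠ 0 := by
    intro ha0
    rw [ha0, zero_mul, zero_add] at hrel
    by_cases hb0 : aeval x b = 0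
    · rw [hb0, zero_mul, zero_add] at hrel
      rw [(map_eq_zero_iff _ hinj).1 ha0, (map_eq_zero_iff _ hinj).1 hb0,
        (map_eq_zero_iff _ hinj).1 hrel] at hsum
      simp [hP0] at hsum
    · refine hz ?_
      have : z = -aeval x c / aeval x b := by
        rw [eq_div_iff hb0]
        linear_combination hrel
      rw [this]
      exact div_mem (neg_mem (aeval_mem_adjoin x c)) (aeval_mem_adjoin x b)
  have h2F : (2 : F) ≠ 0 := by
    rw [← map_ofNat (algebraMap L F) 2]
    exact (_root_.map_ne_zero _).2 h2
  have h2m : (2 : F) ∈ L⟮x⟯ := ofNat_mem _ 2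
  obtain ⟨u, hu, v, hv, hzuv⟩ := h.exists_eq_add_mul z
  have hv0 : v ≠ 0 := by
    rintro rfl
    exact hz (by rw [hzuv, zero_mul, add_zero]; exact hu)
  have ham := aeval_mem_adjoin x a
  -- Completing the square: `(2 a z + b)² = b² - 4 a c`.
  obtain ⟨r, hr, hD⟩ := h.exists_eq_sq_mul h2 hf (D := b ^ 2 - 4 * a * c)
    (p := 2 * aeval x a * u + aeval x b) (q := 2 * aeval x a * v)
    (add_mem (mul_mem (mul_mem h2m ham) hu) (aeval_mem_adjoin x b))
    (mul_mem (mul_mem h2m ham) hv) (mul_ne_zero (mul_ne_zero h2F ha0) hv0) (by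
      simp only [map_sub, map_mul, map_pow, map_ofNat]
      rw [hzuv] at hrel
      linear_combination 4 * aeval x a * hrel)
  have hle : (b ^ 2 - 4 * a * c).natDegree ≤ 4 := by
    refine (natDegree_sub_le _ _).trans (max_le ?_ ?_)
    · exact natDegree_pow_le.trans (by omega)
    · rw [mul_assoc]
      refine natDegree_mul_le.trans ?_
      have h4 : (4 : L[X]).natDegree = 0 := natDegree_ofNat 4
      have := natDegree_mul_le (p := a) (q := c)
      omega
  rw [hD, natDegree_mul (pow_ne_zero 2 hr) hf.ne_zero] at hle
  omega

/-- For two presentations of `F` as a quadratic extension of a rational function field, the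
coordinates `x` and `z` differ by a Möbius transformation. -/
theorem IsQuadraticPair.exists_moebius {f g : L[X]} {x y z w : F} (h : IsQuadraticPair f x y)
    (h' : IsQuadraticPair g z w) (h2 : (2 : L) ≠ 0) (hf : Squarefree f) (hdeg : 5 ≤ f.natDegree) :
    ∃ a b c d : L, a * d - b * c ≠ 0 ∧
      z * aeval x (C c * X + C d) = aeval x (C a * X + C b) := by
  have hz := h.mem_adjoin h' h2 hf hdeg
  obtain ⟨N, hN0, hN, hNz⟩ := exists_linear_relation hz
  obtain ⟨Q, hQ0, hQ, hQz⟩ := exists_linear_relation (h.mem_adjoin_of_mem h' hz)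
  obtain ⟨P, hP0, hPz, hPN, hPQ⟩ := exists_relation_natDegree_le h.transcendental hN0 hQ0 hNz hQz
  have hcoeff (i : ℕ) : (P.coeff i).natDegree ≤ 1 :=
    (natDegree_coeff_le_natDegree_swap P i).trans (hPQ.trans hQ)
  obtain ⟨c, d, hcd⟩ := exists_eq_X_add_C_of_natDegree_le_one (hcoeff 1)
  obtain ⟨a, b, hab⟩ := exists_eq_X_add_C_of_natDegree_le_one (hcoeff 0)
  have hsum := as_sum_range_C_mul_X_pow' P (Nat.lt_succ_of_le (hPN.trans hN))
  simp only [Finset.sum_range_succ, Finset.range_zero, Finset.sum_empty, zero_add, pow_zero,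
    mul_one, pow_one, hcd, hab] at hsum
  have hrel : z * aeval x (C c * X + C d) = aeval x (C (-a) * X + C (-b)) := by
    rw [hsum] at hPz
    rw [map_add, map_mul, aevalAeval_C, aevalAeval_C, aevalAeval_Y] at hPz
    simp only [map_neg, neg_mul, map_add, map_mul] at hPz ⊢
    linear_combination hPz
  refine ⟨-a, -b, c, d, fun hdet => ?_, hrel⟩
  have hinj : Function.Injective (aeval x : L[X] →ₐ[L] F) :=
    transcendental_iff_injective.1 h.transcendental
  have hcd0 : aeval x (C c * X + C d) ≠ 0 := by
    intro h0
    have h1 : aeval x (C (-a) * X + C (-b)) = 0 := by rw [← hrel, h0, mul_zero]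
    have h3 : C a * X + C b = 0 := by
      have := (map_eq_zero_iff _ hinj).1 h1
      simp only [map_neg] at this
      linear_combination -this
    rw [(map_eq_zero_iff _ hinj).1 h0, h3] at hsum
    exact hP0 (by simpa using hsum)
  -- If the determinant vanishes, then `z` is a constant.
  have h3 : (algebraMap L F c * z + algebraMap L F a) * aeval x (C c * X + C d) = 0 := by
    have hdet' := congrArg (algebraMap L F) hdet
    simp only [map_sub, map_mul, map_neg, map_zero] at hdet'
    simp only [map_add, map_mul, map_neg, aeval_C, aeval_X] at hrel ⊢
    linear_combination algebraMap L F c * hrel - hdet'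
  have h4 := (mul_eq_zero.1 h3).resolve_right hcd0
  have h5 : C c * X + C a = 0 := by
    refine (map_eq_zero_iff _ (transcendental_iff_injective.1 h'.transcendental)).1 ?_
    simpa using h4
  have hc0 : c = 0 := by simpa using congrArg (coeff · 1) h5
  have ha0 : a = 0 := by simpa [hc0] using h5
  simp only [hc0, ha0, map_zero, zero_mul, zero_add, neg_zero, map_neg, aeval_C] at hrel hcd0
  have h6 : (C d * X + C b : L[X]) = 0 := by
    refine (map_eq_zero_iff _ (transcendental_iff_injective.1 h'.transcendental)).1 ?_
    simp only [map_add, map_mul, aeval_C, aeval_X]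
    linear_combination hrel
  have hd0 : d = 0 := by simpa using congrArg (coeff · 1) h6
  simp [hd0] at hcd0

/-! ### Branch points and Möbius transformations -/

/-- The binary form `∑ gᵢ sⁱ tᴺ⁻ⁱ` of degree `N` attached to `g`, evaluated at the polynomials `p`
and `q`. -/
def homogSubst (N : ℕ) (g p q : L[X]) : L[X] :=
  ∑ i ∈ Finset.range (N + 1), C (g.coeff i) * p ^ i * q ^ (N - i)

lemma natDegree_homogSubst_le (N : ℕ) (g : L[X]) {p q : L[X]} (hp : p.natDegree ≤ 1)
    (hq : q.natDegree ≤ 1) : (homogSubst N g p q).natDegree ≤ N := by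
  refine natDegree_sum_le_of_forall_le _ _ fun i hi => ?_
  have hi' : i ≤ N := Nat.lt_succ_iff.1 (Finset.mem_range.1 hi)
  have h1 := natDegree_pow_le_of_le i hp
  have h2 := natDegree_pow_le_of_le (N - i) hq
  have h3 := natDegree_C_mul_le (g.coeff i) (p ^ i)
  refine natDegree_mul_le.trans ?_
  omega

lemma coeff_homogSubst (N : ℕ) (g : L[X]) (a b c d : L) :
    (homogSubst N g (C a * X + C b) (C c * X + C d)).coeff N =
      ∑ i ∈ Finset.range (N + 1), g.coeff i * a ^ i * c ^ (N - i) := by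
  rw [homogSubst, finsetSum_coeff]
  refine Finset.sum_congr rfl fun i hi => ?_
  have hi' : i ≤ N := Nat.lt_succ_iff.1 (Finset.mem_range.1 hi)
  rw [mul_assoc, coeff_C_mul, mul_assoc]
  have h1 := coeff_pow_of_natDegree_le (m := i) (natDegree_linear_le (a := a) (b := b))
  have h2 := coeff_pow_of_natDegree_le (m := N - i) (natDegree_linear_le (a := c) (b := d))
  have := coeff_mul_add_eq_of_natDegree_le
    (natDegree_pow_le_of_le i (natDegree_linear_le (a := a) (b := b)))
    (natDegree_pow_le_of_le (N - i) (natDegree_linear_le (a := c) (b := d)))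
  simp only [mul_one] at h1 h2 this
  rw [Nat.add_sub_cancel' hi'] at this
  rw [this, h1, h2]
  simp

/-- The binary form of degree `N` attached to `g` takes at `(s, t)` the value `tᴺ g(s / t)`. -/
lemma sum_coeff_mul_pow_mul_pow {A : Type*} [Field A] [Algebra L A] {N : ℕ} {g : L[X]}
    (hg : g.natDegree ≤ N) {s t r : A} (h : r * t = s) :
    ∑ i ∈ Finset.range (N + 1), algebraMap L A (g.coeff i) * s ^ i * t ^ (N - i) =
      t ^ N * aeval r g := by
  rw [aeval_eq_sum_range' (Nat.lt_succ_of_le hg), Finset.mul_sum]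
  refine Finset.sum_congr rfl fun i hi => ?_
  have hi' : i ≤ N := Nat.lt_succ_iff.1 (Finset.mem_range.1 hi)
  rw [← h, mul_pow, Algebra.smul_def, ← Nat.sub_add_cancel hi', pow_add, Nat.add_sub_cancel]
  ring

/-- The binary form of degree `N` attached to `g` takes at `(s, 0)` the value `g_N sᴺ`. -/
lemma sum_coeff_mul_pow_mul_zero_pow {N : ℕ} (g : L[X]) (s : L) :
    ∑ i ∈ Finset.range (N + 1), g.coeff i * s ^ i * 0 ^ (N - i) = g.coeff N * s ^ N := by
  rw [Finset.sum_range_succ, Finset.sum_eq_zero]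
  · simp
  · intro i hi
    rw [zero_pow (Nat.sub_ne_zero_of_lt (Finset.mem_range.1 hi)), mul_zero]

/-- The Möbius transformation relating `x` and `z` carries `g` to a constant multiple of `f`. -/
theorem IsQuadraticPair.exists_homogSubst_eq {m : ℕ} {f g : L[X]} {x y z w : F}
    (h : IsQuadraticPair f x y)
    (h' : IsQuadraticPair g z w) (h2 : (2 : L) ≠ 0) (hf : Squarefree f) (hdeg : 5 ≤ f.natDegree)
    (hfm : 2 * m ≤ f.natDegree + 1) (hgm : g.natDegree ≤ 2 * m) :
    ∃ a b c d κ : L, a * d - b * c ≠ 0 ∧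
      homogSubst (2 * m) g (C a * X + C b) (C c * X + C d) = C κ * f := by
  obtain ⟨a, b, c, d, hdet, hz⟩ := h.exists_moebius h' h2 hf hdeg
  refine ⟨a, b, c, d, ?_⟩
  have hzx := h.mem_adjoin h' h2 hf hdeg
  have hxz := h.mem_adjoin_of_mem h' hzx
  have hw : w ∉ L⟮x⟯ := fun hw => h'.notMem ((show L⟮x⟯ ≤ L⟮z⟯ by simpa using hxz) hw)
  have hinj : Function.Injective (aeval x : L[X] →ₐ[L] F) :=
    transcendental_iff_injective.1 h.transcendental
  have hcd : aeval x (C c * X + C d) ≠ 0 := by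
    intro h0
    have h1 := (map_eq_zero_iff _ hinj).1 h0
    have hc0 : c = 0 := by simpa using congrArg (coeff · 1) h1
    have hd0 : d = 0 := by simpa [hc0] using h1
    simp [hc0, hd0] at hdet
  set t := aeval x (C c * X + C d) with ht
  obtain ⟨u, hu, v, hv, hwuv⟩ := h.exists_eq_add_mul w
  have hv0 : v ≠ 0 := by
    rintro rfl
    exact hw (by rw [hwuv, zero_mul, add_zero]; exact hu)
  have htm : t ^ m ∈ L⟮x⟯ := pow_mem (aeval_mem_adjoin x _) m
  -- `(c x + d)ᵐ w` is not in `L(x)`, and its square is the form attached to `g` at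
  -- `(a x + b, c x + d)`.
  obtain ⟨r, hr, hG⟩ := h.exists_eq_sq_mul h2 hf
    (D := homogSubst (2 * m) g (C a * X + C b) (C c * X + C d)) (mul_mem htm hu) (mul_mem htm hv)
    (mul_ne_zero (pow_ne_zero m hcd) hv0) (by
      have := sum_coeff_mul_pow_mul_pow hgm hz
      simp only [homogSubst, map_sum, map_mul, map_pow, aeval_C]
      rw [← ht, this, ← h'.sq_eq, hwuv]
      ring)
  have hle := natDegree_homogSubst_le (2 * m) g (natDegree_linear_le (a := a) (b := b))
    (natDegree_linear_le (a := c) (b := d))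
  rw [hG, natDegree_mul (pow_ne_zero 2 hr) hf.ne_zero, natDegree_pow] at hle
  obtain ⟨ρ, rfl⟩ := natDegree_eq_zero.1 (show r.natDegree = 0 by omega)
  refine ⟨ρ ^ 2, hdet, ?_⟩
  rw [hG, C_pow]

end FunctionField

section Moebius
open Polynomial OnePoint Matrix

variable {L : Type*} [Field L]

/-- The zeros in the projective line of the binary form of degree `N` attached to `f`: the roots of
`f`, and `∞` if the coefficient of degree `N` vanishes. If `f` is squarefree of degree `N` or `N -
1`, with `N` even, these are the branch points of `y² = f(x)`. -/
def branchSet (N : ℕ) (f : L[X]) : Set (OnePoint L) :=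
  {p | p.elim (f.coeff N) (fun a => f.eval a) = 0}

@[simp] lemma infty_mem_branchSet {N : ℕ} {f : L[X]} : ∞ ∈ branchSet N f ↔ f.coeff N = 0 := Iff.rfl

@[simp] lemma coe_mem_branchSet {N : ℕ} {f : L[X]} {a : L} :
    (a : OnePoint L) ∈ branchSet N f ↔ f.eval a = 0 := Iff.rfl

open Classical in
theorem exists_smul_mem_branchSet {N : ℕ} {f g : L[X]} (hg : g.natDegree ≤ N)
    {a b c d κ : L} (hdet : a * d - b * c ≠ 0)
    (h : homogSubst N g (C a * X + C b) (C c * X + C d) = C κ * f) :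
    ∃ γ : GL (Fin 2) L, ∀ p ∈ branchSet N f, γ • p ∈ branchSet N g := by
  refine ⟨GeneralLinearGroup.mkOfDetNeZero !![a, b; c, d] (by rwa [det_fin_two_of]), ?_⟩
  intro p hp
  have hz (s t : L) (hst : s ≠ 0 ∨ t ≠ 0)
      (h0 : ∑ i ∈ Finset.range (N + 1), g.coeff i * s ^ i * t ^ (N - i) = 0) :
      (if t = 0 then ∞ else ((s / t : L) : OnePoint L)) ∈ branchSet N g := by
    split_ifs with ht
    · subst ht
      rw [sum_coeff_mul_pow_mul_zero_pow] at h0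
      exact (mul_eq_zero.1 h0).resolve_right (pow_ne_zero N (by simpa using hst))
    · have := sum_coeff_mul_pow_mul_pow (A := L) hg (div_mul_cancel₀ s ht)
      simp only [Algebra.algebraMap_self_apply] at this
      rw [h0] at this
      rw [coe_mem_branchSet, ← coe_aeval_eq_eval]
      exact (mul_eq_zero.1 this.symm).resolve_left (pow_ne_zero N ht)
  cases p with
  | infty =>
    rw [smul_infty_eq_ite]
    refine hz a c ?_ ?_
    · by_contra! hac
      simp [hac.1, hac.2] at hdet
    · rw [← coeff_homogSubst N g a b c d, h, coeff_C_mul, infty_mem_branchSet.1 hp, mul_zero]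
  | coe α =>
    rw [smul_some_eq_ite]
    refine hz (a * α + b) (c * α + d) ?_ ?_
    · by_contra! hac
      apply hdet
      linear_combination a * hac.2 - c * hac.1
    · have := congrArg (eval α) h
      rw [homogSubst, eval_finsetSum] at this
      simp only [eval_mul, eval_pow, eval_C, eval_add, eval_X, coe_mem_branchSet.1 hp,
        mul_zero] at this
      exact this

open Classical in
lemma smul_eq_self_of_three_fixed {γ : GL (Fin 2) L} {p q r : OnePoint L} (hpq : p ≠ q)
    (hpr : p ≠ r) (hqr : q ≠ r) (hp : γ • p = p) (hq : γ • q = q) (hr : γ • r = r)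
    (s : OnePoint L) : γ • s = s := by
  have h0 : γ.fixpointPolynomial = 0 := by
    by_contra hne
    have hroot (a : L) : γ • (a : OnePoint L) = a ↔ γ.fixpointPolynomial.IsRoot a := by
      rw [← GeneralLinearGroup.fixpointPolynomial_aeval_eq_zero_iff, IsRoot.def, coe_aeval_eq_eval]
    have hcard (S : Finset L) (hS : ∀ a ∈ S, γ • (a : OnePoint L) = a) :
        S.card ≤ γ.fixpointPolynomial.natDegree :=
      (Finset.card_le_card fun a ha => by
        rw [Multiset.mem_toFinset, mem_roots hne, ← hroot]
        exact hS a ha).trans ((Multiset.toFinset_card_le _).trans (card_roots' _))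
    have h2 : γ.fixpointPolynomial.natDegree ≤ 2 := by
      rw [GeneralLinearGroup.fixpointPolynomial]
      compute_degree
    have h1 (hinf : γ • (∞ : OnePoint L) = ∞) : γ.fixpointPolynomial.natDegree ≤ 1 := by
      rw [GeneralLinearGroup.fixpointPolynomial, smul_infty_eq_self_iff.1 hinf]
      simp only [map_zero, zero_mul, zero_add]
      compute_degree
    have two (hinf : γ • (∞ : OnePoint L) = ∞) (a b : L) (hab : a ≠ b)
        (ha : γ • (a : OnePoint L) = a) (hb : γ • (b : OnePoint L) = b) : False := by
      have := hcard {a, b} (by simp [ha, hb])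
      rw [Finset.card_pair hab] at this
      have := h1 hinf
      omega
    cases p with
    | infty =>
      cases q with
      | infty => exact hpq rfl
      | coe q =>
        cases r with
        | infty => exact hpr rfl
        | coe r => exact two hp q r (fun h => hqr (by rw [h])) hq hr
    | coe p =>
      cases q with
      | infty =>
        cases r with
        | infty => exact hqr rfl
        | coe r => exact two hq p r (fun h => hpr (by rw [h])) hp hr
      | coe q =>
        cases r with
        | infty => exact two hr p q (fun h => hpq (by rw [h])) hp hq
        | coe r =>
          have := hcard {p, q, r} (by simp [hp, hq, hr])
          rw [Finset.card_eq_three.2 ⟨p, q, r, fun h => hpq (by rw [h]),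
            fun h => hpr (by rw [h]), fun h => hqr (by rw [h]), rfl⟩] at this
          omega
  have hb : γ 0 1 = 0 := by
    simpa [GeneralLinearGroup.fixpointPolynomial] using congr_arg (coeff · 0) h0
  have hc : γ 1 0 = 0 := by
    simpa [GeneralLinearGroup.fixpointPolynomial] using congr_arg (coeff · 2) h0
  have hd : γ 1 1 - γ 0 0 = 0 := by
    simpa [GeneralLinearGroup.fixpointPolynomial] using congr_arg (coeff · 1) h0
  cases s with
  | infty => exact smul_infty_eq_self_iff.2 hc
  | coe s =>
    rw [← GeneralLinearGroup.fixpointPolynomial_aeval_eq_zero_iff, h0, map_zero]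

open Classical in
lemma smul_eq_smul_of_three {γ δ : GL (Fin 2) L} {p q r : OnePoint L} (hpq : p ≠ q)
    (hpr : p ≠ r) (hqr : q ≠ r) (hp : γ • p = δ • p) (hq : γ • q = δ • q) (hr : γ • r = δ • r)
    (s : OnePoint L) : γ • s = δ • s := by
  have h := smul_eq_self_of_three_fixed (γ := δ⁻¹ * γ) hpq hpr hqr
  simp only [mul_smul, inv_smul_eq_iff] at h
  exact h hp hq hr s

open Classical in
/-- The Möbius transformations, as maps, that send at least three points of `R` into `R`. -/
def moebiusMaps (R : Finset (OnePoint L)) : Set (OnePoint L → OnePoint L) :=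
  {φ | ∃ γ : GL (Fin 2) L, (∀ p, φ p = γ • p) ∧ 2 < (R.filter fun p => γ • p ∈ R).card}

/-- A Möbius transformation is determined by its values at three points, so there are at most as
many elements of `moebiusMaps R` as there are ways to prescribe three values in `R` at three points
of `R`. -/
lemma finite_moebiusMaps (R : Finset (OnePoint L)) : (moebiusMaps R).Finite := by
  classical
  let I := R ×ˢ R ×ˢ R ×ˢ R ×ˢ R ×ˢ R
  refine (I.finite_toSet.biUnion (t := fun i => {φ | (∃ γ : GL (Fin 2) L, ∀ p, φ p = γ • p) ∧
    i.1 ≠ i.2.1 ∧ i.1 ≠ i.2.2.1 ∧ i.2.1 ≠ i.2.2.1 ∧ φ i.1 = i.2.2.2.1 ∧ φ i.2.1 = i.2.2.2.2.1 ∧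
      φ i.2.2.1 = i.2.2.2.2.2}) fun i _ => Set.Subsingleton.finite ?_).subset ?_
  · rintro φ ⟨⟨γ, hγ⟩, h1, h2, h3, e1, e2, e3⟩ ψ ⟨⟨δ, hδ⟩, -, -, -, e1', e2', e3'⟩
    funext s
    rw [hγ, hδ]
    refine smul_eq_smul_of_three h1 h2 h3 ?_ ?_ ?_ s
    · rw [← hγ, ← hδ, e1, e1']
    · rw [← hγ, ← hδ, e2, e2']
    · rw [← hγ, ← hδ, e3, e3']
  · rintro φ ⟨γ, hγ, hcard⟩
    obtain ⟨p, q, r, hp, hq, hr, hpq, hpr, hqr⟩ := Finset.two_lt_card_iff.1 hcard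
    rw [Finset.mem_filter] at hp hq hr
    refine Set.mem_biUnion (x := (p, q, r, γ • p, γ • q, γ • r)) ?_
      ⟨⟨γ, hγ⟩, hpq, hpr, hqr, hγ p, hγ q, hγ r⟩
    simp [I, hp, hq, hr]

/-- The points sent into `R` by some element of `moebiusMaps R`, and the points at which two
distinct elements of `moebiusMaps R` coincide. -/
def exceptionalPoints (R : Finset (OnePoint L)) : Set (OnePoint L) :=
  (⋃ φ ∈ moebiusMaps R, φ ⁻¹' R) ∪
    ⋃ φ ∈ moebiusMaps R, ⋃ ψ ∈ moebiusMaps R, {p | φ p = ψ p ∧ φ ≠ ψ}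

lemma finite_exceptionalPoints (R : Finset (OnePoint L)) : (exceptionalPoints R).Finite := by
  classical
  have hfin := finite_moebiusMaps R
  refine Set.Finite.union (hfin.biUnion fun φ hφ => ?_)
    (hfin.biUnion fun φ hφ => hfin.biUnion fun ψ hψ => ?_)
  · obtain ⟨γ, hγ, -⟩ := hφ
    refine R.finite_toSet.preimage fun p _ q _ hpq => ?_
    rw [hγ, hγ] at hpq
    exact MulAction.injective γ hpq
  · obtain ⟨γ, hγ, -⟩ := hφ
    obtain ⟨δ, hδ, -⟩ := hψ
    by_contra hinf
    obtain ⟨S, hS, hcard⟩ := Set.Infinite.exists_subset_card_eq hinf 3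
    obtain ⟨p, q, r, hpq, hpr, hqr, rfl⟩ := Finset.card_eq_three.1 hcard
    have hmem (s) (hs : s ∈ ({p, q, r} : Finset (OnePoint L))) : γ • s = δ • s ∧ φ ≠ ψ := by
      have := hS hs
      rwa [Set.mem_ofPred_eq, hγ, hδ] at this
    refine (hmem p (by simp)).2 (funext fun s => ?_)
    rw [hγ, hδ]
    exact smul_eq_smul_of_three hpq hpr hqr (hmem p (by simp)).1 (hmem q (by simp)).1
      (hmem r (by simp)).1 s

end Moebius

/-! ### The exceptional points -/

section Galois
open OnePoint Matrix

variable {K L : Type*} [Field K] [Field L] [Algebra K L]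

open Classical in
/-- Let `R` be stable under the Galois group, such that the stabiliser of each finite point of `R`
moves all the other finite points. If a Möbius transformation carries `R ∪ {t₁}` into `R ∪ {t₂}` for
distinct `t₁, t₂ ∈ K`, then `t₁` is an exceptional point of `R`. -/
theorem mem_exceptionalPoints {R : Finset (OnePoint L)} (hR : 7 ≤ R.card)
    (hstable : ∀ σ : Gal(L/K), ∀ p ∈ R, OnePoint.map σ p ∈ R)
    (hmove : ∀ a b : L, (a : OnePoint L) ∈ R → (b : OnePoint L) ∈ R → a ≠ b →
      ∃ σ : Gal(L/K), σ a = a ∧ σ b ≠ b)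
    {t₁ t₂ : K} (hne : t₁ ≠ t₂) (hT : ((algebraMap K L t₁ : L) : OnePoint L) ∉ R) {γ : GL (Fin 2) L}
    (hγ : ∀ p ∈ insert ((algebraMap K L t₁ : L) : OnePoint L) R,
      γ • p ∈ insert ((algebraMap K L t₂ : L) : OnePoint L) R) :
    ((algebraMap K L t₁ : L) : OnePoint L) ∈ exceptionalPoints R := by
  set T₁ := ((algebraMap K L t₁ : L) : OnePoint L) with hT₁
  set T₂ := ((algebraMap K L t₂ : L) : OnePoint L) with hT₂
  have hinj := MulAction.injective (α := GL (Fin 2) L) (β := OnePoint L)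
  -- At most one point of `R` is sent to `T₂`.
  have hφ : (γ • · : OnePoint L → OnePoint L) ∈ moebiusMaps R := by
    refine ⟨γ, fun p => rfl, ?_⟩
    have hsub : R.erase (γ⁻¹ • T₂) ⊆ R.filter fun p => γ • p ∈ R := fun p hp => by
      rw [Finset.mem_erase] at hp
      refine Finset.mem_filter.2 ⟨hp.2, (Finset.mem_insert.1 (hγ p
        (Finset.mem_insert_of_mem hp.2))).resolve_left fun h => hp.1 ?_⟩
      rw [← h, inv_smul_smul]
    have := Finset.card_le_card hsub
    have := Finset.pred_card_le_card_erase (s := R) (a := γ⁻¹ • T₂)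
    omega
  rcases Finset.mem_insert.1 (hγ T₁ (Finset.mem_insert_self _ _)) with h12 | hmem
  swap
  · exact Or.inl (Set.mem_biUnion hφ hmem)
  have hγR (p) (hp : p ∈ R) : γ • p ∈ R := by
    refine (Finset.mem_insert.1 (hγ p (Finset.mem_insert_of_mem hp))).resolve_left fun h => hT ?_
    rw [← h12] at h
    rwa [← hinj γ h]
  by_contra hexc
  have hconj (σ : Gal(L/K)) (p : OnePoint L) :
      OnePoint.map σ (γ • p) = (γ.map (σ : L →+* L)) • OnePoint.map σ p :=
    OnePoint.map_smul (σ : L →+* L) γ p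
  -- As `t₁` is not exceptional, `γ` is equal to its Galois conjugates.
  have hcomm (σ : Gal(L/K)) (p : OnePoint L) : γ • p = (γ.map (σ : L →+* L)) • p := by
    by_contra hp
    refine hexc (Or.inr (Set.mem_biUnion hφ (Set.mem_biUnion (x := fun p => γ.map (σ : L →+* L) • p)
      ⟨γ.map (σ : L →+* L), fun p => rfl, ?_⟩ ⟨?_, fun h => hp (congrFun h p)⟩)))
    · rw [Finset.filter_true_of_mem]
      · omega
      · intro q hq
        have h1 := hconj σ (OnePoint.map σ.symm q)
        have h2 : OnePoint.map σ (OnePoint.map σ.symm q) = q := by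
          cases q <;> simp
        rw [h2] at h1
        rw [← h1]
        exact hstable σ _ (hγR _ (hstable σ.symm q hq))
    · have h1 := hconj σ T₁
      have e₁ : OnePoint.map σ T₁ = T₁ := by simp [hT₁]
      have e₂ : OnePoint.map σ T₂ = T₂ := by simp [hT₂]
      rw [h12, e₁, e₂] at h1
      exact h12.trans h1
  -- The stabiliser of `a` fixes `γ a`, since `γ` commutes with the Galois group.
  have hfix (a : L) (ha : (a : OnePoint L) ∈ R) :
      γ • (a : OnePoint L) = a ∨ γ • (a : OnePoint L) = ∞ := by
    by_contra! hcon
    obtain ⟨b, hb⟩ := OnePoint.ne_infty_iff_exists.1 hcon.2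
    have hab : a ≠ b := fun h => hcon.1 (by rw [← hb, h])
    obtain ⟨σ, hσa, hσb⟩ := hmove a b ha (by rw [hb]; exact hγR _ ha) hab
    have h1 := hconj σ a
    rw [← hcomm, ← hb, OnePoint.map_some, OnePoint.map_some, hσa, ← hb] at h1
    exact hσb (OnePoint.coe_eq_coe.1 h1)
  -- Only one point is sent to `∞`, so at least five finite points of `R` are fixed.
  have hcard : 2 < ((R.erase ∞).erase (γ⁻¹ • ∞)).card := by
    have h1 := Finset.pred_card_le_card_erase (s := R) (a := ∞)
    have h2 := Finset.pred_card_le_card_erase (s := R.erase ∞) (a := γ⁻¹ • ∞)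
    omega
  have hfix' (p) (hp : p ∈ (R.erase ∞).erase (γ⁻¹ • ∞)) : γ • p = p := by
    simp only [Finset.mem_erase] at hp
    obtain ⟨hp1, hp2, hp3⟩ := hp
    obtain ⟨a, rfl⟩ := OnePoint.ne_infty_iff_exists.1 hp2
    exact (hfix a hp3).resolve_right fun h => hp1 (by rw [← h, inv_smul_smul])
  obtain ⟨p, q, r, hp, hq, hr, hpq, hpr, hqr⟩ := Finset.two_lt_card_iff.1 hcard
  have h1 := smul_eq_self_of_three_fixed hpq hpr hqr (hfix' p hp) (hfix' q hq) (hfix' r hr) T₁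
  rw [h12] at h1
  exact hne ((algebraMap K L).injective (OnePoint.coe_eq_coe.1 h1.symm))

end Galois

/-! ### Large Galois groups -/

section Galois
open Polynomial

variable {K : Type*} [Field K]

lemma factorial_le_two_mul_card_gal {m : ℕ} {h : K[X]} (hm : 2 ≤ m)
    (hgal : Nonempty (h.Gal ≃* Equiv.Perm (Fin m)) ∨
      Nonempty (h.Gal ≃* alternatingGroup (Fin m))) : m.factorial ≤ 2 * Nat.card h.Gal := by
  rcases hgal with ⟨⟨e⟩⟩ | ⟨⟨e⟩⟩
  · rw [Nat.card_congr e.toEquiv, Nat.card_perm, Nat.card_fin]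
    omega
  · have : Nontrivial (Fin m) := Fin.nontrivial_iff_two_le.2 hm
    rw [Nat.card_congr e.toEquiv, Nat.card_eq_fintype_card, two_mul_card_alternatingGroup,
      Fintype.card_perm, Fintype.card_fin]

variable {L : Type*} [Field L] [Algebra K L]

/-- A polynomial of degree `m` with fewer than `m` roots has a Galois group of order at most `(m -
1)! < m! / 2`. -/
lemma card_rootSet_eq {m : ℕ} {h : K[X]} [Fact ((h.map (algebraMap K L)).Splits)] (hm : 3 ≤ m)
    (hdeg : h.natDegree = m) (hcard : m.factorial ≤ 2 * Nat.card h.Gal) :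
    Fintype.card (h.rootSet L) = m := by
  classical
  have hle : Fintype.card (h.rootSet L) ≤ m := by
    rw [← hdeg, ← Nat.card_eq_fintype_card, Nat.card_coe_set_eq]
    exact h.ncard_rootSet_le L
  refine hle.eq_of_not_lt fun hlt => ?_
  have h1 := Nat.card_le_card_of_injective _ (Gal.galActionHom_injective h L)
  rw [Nat.card_perm, Nat.card_eq_fintype_card (α := h.rootSet L)] at h1
  obtain ⟨k, rfl⟩ : ∃ k, m = k + 1 := ⟨m - 1, by omega⟩
  have h2 := Nat.factorial_le (Nat.le_of_lt_succ hlt)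
  rw [Nat.factorial_succ] at hcard
  have := Nat.factorial_pos k
  nlinarith

/-- The Galois group contains the alternating group on the roots, as its index is at most `2`, hence
contains a three-cycle that moves `b` and fixes `a`. -/
lemma exists_gal_fix_move {m : ℕ} {h : K[X]} [Fact ((h.map (algebraMap K L)).Splits)] [Normal K L]
    (hm : 4 ≤ m) (hdeg : h.natDegree = m) (hcard : m.factorial ≤ 2 * Nat.card h.Gal)
    {a b : L} (ha : a ∈ h.rootSet L) (hb : b ∈ h.rootSet L) (hab : a ≠ b) :
    ∃ σ : Gal(L/K), σ a = a ∧ σ b ≠ b := by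
  classical
  have hroots := card_rootSet_eq (L := L) (by omega) hdeg hcard
  have hindex : (Gal.galActionHom h L).range.index ≤ 2 := by
    have h1 := (Gal.galActionHom h L).range.index_mul_card
    rw [Nat.card_congr (MonoidHom.ofInjective (Gal.galActionHom_injective h L)).symm.toEquiv,
      Nat.card_perm, Nat.card_eq_fintype_card (α := h.rootSet L), hroots] at h1
    have h2 := Nat.factorial_pos m
    by_contra! h3
    nlinarith
  have halt := Equiv.Perm.alternatingGroup_le_of_index_le_two hindex
  let a' : h.rootSet L := ⟨a, ha⟩
  let b' : h.rootSet L := ⟨b, hb⟩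
  have hab' : a' ≠ b' := fun e => hab (congrArg Subtype.val e)
  have hcompl : 1 < (({a', b'} : Finset (h.rootSet L))ᶜ).card := by
    rw [Finset.card_compl, hroots, Finset.card_pair hab']
    omega
  obtain ⟨c, hc, d, hd, hcd⟩ := Finset.one_lt_card.1 hcompl
  simp only [Finset.mem_compl, Finset.mem_insert, Finset.mem_singleton, not_or] at hc hd
  have hmem : Equiv.swap b' c * Equiv.swap c d ∈ alternatingGroup (h.rootSet L) := by
    rw [Equiv.Perm.mem_alternatingGroup, Equiv.Perm.sign_mul, Equiv.Perm.sign_swap (Ne.symm hc.2),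
      Equiv.Perm.sign_swap hcd]
    simp
  obtain ⟨τ, hτ⟩ := halt hmem
  obtain ⟨σ, rfl⟩ := Gal.restrict_surjective h L τ
  have hσ (x : h.rootSet L) : σ x = (Equiv.swap b' c * Equiv.swap c d) x := by
    rw [← hτ, Gal.galActionHom_restrict]
  refine ⟨σ, ?_, fun e => hc.2 ?_⟩
  · rw [hσ a', Equiv.Perm.mul_apply, Equiv.swap_apply_of_ne_of_ne (Ne.symm hc.1) (Ne.symm hd.1),
      Equiv.swap_apply_of_ne_of_ne hab' (Ne.symm hc.1)]
  · have h1 := hσ b'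
    rw [Equiv.Perm.mul_apply, Equiv.swap_apply_of_ne_of_ne (Ne.symm hc.2) (Ne.symm hd.2),
      Equiv.swap_apply_left] at h1
    exact Subtype.ext (h1.symm.trans e)

/-- In positive characteristic an irreducible polynomial may be inseparable; a large Galois group
excludes this. -/
lemma separable_of_card_gal {m : ℕ} {h : K[X]} (hm : 3 ≤ m)
    (hdeg : h.natDegree = m) (hcard : m.factorial ≤ 2 * Nat.card h.Gal) : h.Separable := by
  have : Fact ((h.map (algebraMap K (AlgebraicClosure K))).Splits) := ⟨IsAlgClosed.splits _⟩
  rw [← card_rootSet_eq_natDegree_iff_of_splits (K := AlgebraicClosure K)]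
  · rw [card_rootSet_eq hm hdeg hcard, hdeg]
  · rintro rfl
    simp at hdeg
    omega
  · exact this.out

lemma eval_ne_zero_of_irreducible {h : K[X]} (hirr : Irreducible h) (hdeg : 2 ≤ h.natDegree)
    (t : K) : h.eval t ≠ 0 := fun ht => by
  have := natDegree_eq_of_degree_eq_some (n := 1) (degree_eq_one_of_irreducible_of_root hirr ht)
  omega

lemma separable_X_sub_C_mul {h : K[X]} (hsep : h.Separable) {t : K} (ht : h.eval t ≠ 0) :
    ((X - C t) * h).Separable :=
  separable_X_sub_C.mul hsep (((irreducible_X_sub_C t).isCoprime_or_dvd h).resolve_right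
    fun hd => ht (dvd_iff_isRoot.1 hd))

end Galois

/-! ### The coordinate rings of the charts -/

section CoordRing
open Polynomial
open scoped Polynomial.Bivariate IntermediateField
universe u
variable {k : Type u} [Field k]

lemma isDomain_coordRing {f : k[X]} (hf : ¬ IsSquare f) : IsDomain (CoordRing f) := by
  have hm : (X ^ 2 - C f : k[X][Y]).Monic := monic_X_pow_sub_C f two_ne_zero
  have hd : (X ^ 2 - C f : k[X][Y]).natDegree = 2 := natDegree_X_pow_sub_C
  refine AdjoinRoot.isDomain_of_prime (Irreducible.prime ?_)
  rw [hm.irreducible_iff_roots_eq_zero_of_degree_le_three hd.ge (by omega),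
    Multiset.eq_zero_iff_forall_notMem]
  intro r hr
  have := isRoot_of_mem_roots hr
  simp only [IsRoot.def, eval_sub, eval_pow, eval_X, eval_C, sub_eq_zero] at this
  exact hf ⟨r, by rw [← this, sq]⟩

lemma not_isSquare_of_squarefree {f : k[X]} (hf : Squarefree f) (hdeg : f.natDegree ≠ 0) :
    ¬ IsSquare f := by
  rintro ⟨r, rfl⟩
  have := hf r dvd_rfl
  rw [isUnit_iff_degree_eq_zero, degree_eq_natDegree] at this
  · have h0 : r.natDegree = 0 := by exact_mod_cast this
    exact hdeg (by rw [natDegree_mul' , h0]; simpa using hf.ne_zero)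
  · rintro rfl
    simp at hdeg

/-- Reversal respects products, so `reversed f` is a square only if `f` is. -/
lemma not_isSquare_reversed {f : k[X]} (hf : ¬ IsSquare f) : ¬ IsSquare (reversed f) := by
  rintro ⟨r, hr⟩
  have h1 := natDegree_reversed_le f
  have hrdeg : r.natDegree ≤ halfDegree f := by
    rw [hr] at h1
    by_cases hr0 : r = 0
    · simp [hr0]
    · rw [natDegree_mul hr0 hr0] at h1
      omega
  refine hf ⟨r.reflect (halfDegree f), ?_⟩
  rw [← reflect_mul r r hrdeg hrdeg, ← hr, ← two_mul, reversed, reflect_reflect]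

lemma injective_coordRing_of (f : k[X]) :
    Function.Injective (AdjoinRoot.of (X ^ 2 - C f : k[X][Y])) :=
  AdjoinRoot.of.injective_of_degree_ne_zero (by
    rw [degree_X_pow_sub_C two_pos]
    norm_num)

lemma xCoord_ne_zero (f : k[X]) : xCoord f ≠ 0 :=
  (map_ne_zero_iff _ (injective_coordRing_of f)).2 X_ne_zero

lemma aeval_xCoord (f p : k[X]) :
    aeval (xCoord f) p = AdjoinRoot.of (X ^ 2 - C f : k[X][Y]) p := by
  have : AdjoinRoot.ofAlgHom k (X ^ 2 - C f : k[X][Y]) = aeval (xCoord f) :=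
    algHom_ext (by simp [xCoord])
  rw [← this]
  rfl

lemma exists_eq_aeval_add_mul_yCoord (f : k[X]) (a : CoordRing f) :
    ∃ p q : k[X], a = aeval (xCoord f) p + aeval (xCoord f) q * yCoord f := by
  have hm : (X ^ 2 - C f : k[X][Y]).Monic := monic_X_pow_sub_C f two_ne_zero
  have hd : (X ^ 2 - C f : k[X][Y]).natDegree = 2 := natDegree_X_pow_sub_C
  obtain ⟨P, rfl⟩ := AdjoinRoot.mk_surjective a
  have h1 := natDegree_modByMonic_lt P hm (fun h => by rw [h] at hd; simp at hd)
  rw [hd] at h1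
  obtain ⟨q, p, hpq⟩ := exists_eq_X_add_C_of_natDegree_le_one (Nat.le_of_lt_succ h1)
  refine ⟨p, q, ?_⟩
  have h2 : AdjoinRoot.mk (X ^ 2 - C f) P = AdjoinRoot.mk (X ^ 2 - C f) (P %ₘ (X ^ 2 - C f)) := by
    rw [AdjoinRoot.mk_eq_mk]
    exact ⟨P /ₘ (X ^ 2 - C f), by linear_combination -(modByMonic_add_div P (X ^ 2 - C f))⟩
  rw [h2, hpq, map_add, map_mul, AdjoinRoot.mk_X, AdjoinRoot.mk_C, AdjoinRoot.mk_C, aeval_xCoord,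
    aeval_xCoord, yCoord, add_comm]

lemma aeval_xCoord_mul_yCoord_ne {f p q : k[X]} (hq : q ≠ 0) :
    aeval (xCoord f) q * yCoord f ≠ aeval (xCoord f) p := by
  intro h
  rw [aeval_xCoord, aeval_xCoord, yCoord, ← AdjoinRoot.mk_C, ← AdjoinRoot.mk_C, ← AdjoinRoot.mk_X,
    ← map_mul, AdjoinRoot.mk_eq_mk] at h
  have hm : (X ^ 2 - C f : k[X][Y]).Monic := monic_X_pow_sub_C f two_ne_zero
  have hd : (X ^ 2 - C f : k[X][Y]).natDegree = 2 := natDegree_X_pow_sub_C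
  refine hm.not_dvd_of_natDegree_lt (fun h0 => hq ?_) ?_ h
  · simpa using congrArg (coeff · 1) h0
  · rw [hd]
    exact (by compute_degree : (C q * X - C p : k[X][Y]).natDegree ≤ 1).trans_lt one_lt_two

/-- The field of fractions of `k[x, y] / (y² - f(x))` is the function field of `y² = f(x)`. -/
theorem isQuadraticPair_of_isFractionRing {f : k[X]} {F : Type*} [Field F] [Algebra k F]
    (α : CoordRing f →ₐ[k] F) (hα : Function.Injective α)
    (hfrac : ∀ z, ∃ a b, z = α a / α b) : IsQuadraticPair f (α (xCoord f)) (α (yCoord f)) := by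
  have haeval (p : k[X]) : aeval (α (xCoord f)) p = α (aeval (xCoord f) p) :=
    aeval_algHom_apply α (xCoord f) p
  have htr : Transcendental k (α (xCoord f)) := by
    rw [transcendental_iff_injective]
    intro p q hpq
    rw [haeval, haeval] at hpq
    have := hα hpq
    rw [aeval_xCoord, aeval_xCoord] at this
    exact injective_coordRing_of f this
  have hsq : α (yCoord f) ^ 2 = aeval (α (xCoord f)) f := by
    rw [← map_pow, yCoord_sq, haeval]
  have hnot : α (yCoord f) ∉ k⟮α (xCoord f)⟯ := by
    intro h
    obtain ⟨r, s, hs, hrs⟩ := exists_mul_aeval_eq h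
    rw [haeval, haeval, ← map_mul, mul_comm] at hrs
    refine aeval_xCoord_mul_yCoord_ne (fun h0 => hs ?_) (hα hrs)
    rw [h0, map_zero]
  refine ⟨htr, hsq, fun z => ?_, hnot⟩
  obtain ⟨a, b, rfl⟩ := hfrac z
  by_cases hb : α b = 0
  · exact ⟨0, zero_mem _, 0, zero_mem _, by simp [hb]⟩
  obtain ⟨p, q, rfl⟩ := exists_eq_aeval_add_mul_yCoord f a
  obtain ⟨r, s, rfl⟩ := exists_eq_aeval_add_mul_yCoord f b
  simp only [map_add, map_mul, ← haeval] at hb ⊢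
  set x := α (xCoord f)
  set y := α (yCoord f)
  -- The norm of a nonzero element is nonzero.
  have hnorm : aeval x r ^ 2 - aeval x s ^ 2 * aeval x f ≠ 0 := by
    intro h0
    have h1 : (aeval x r + aeval x s * y) * (aeval x r - aeval x s * y) = 0 := by
      linear_combination h0 - aeval x s ^ 2 * hsq
    have h2 := (mul_eq_zero.1 h1).resolve_left hb
    by_cases hs : aeval x s = 0
    · rw [hs] at h2 hb
      simp only [zero_mul, sub_zero, add_zero] at h2 hb
      exact hb h2
    · refine hnot ?_
      have : y = aeval x r / aeval x s := by
        rw [eq_div_iff hs]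
        linear_combination -h2
      rw [this]
      exact div_mem (aeval_mem_adjoin x r) (aeval_mem_adjoin x s)
  refine ⟨(aeval x p * aeval x r - aeval x q * aeval x s * aeval x f) /
      (aeval x r ^ 2 - aeval x s ^ 2 * aeval x f), ?_,
    (aeval x q * aeval x r - aeval x p * aeval x s) /
      (aeval x r ^ 2 - aeval x s ^ 2 * aeval x f), ?_, ?_⟩
  · simp only [← map_mul, ← map_pow, ← map_sub]
    exact div_mem (aeval_mem_adjoin x _) (aeval_mem_adjoin x _)
  · simp only [← map_mul, ← map_pow, ← map_sub]
    exact div_mem (aeval_mem_adjoin x _) (aeval_mem_adjoin x _)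
  · rw [div_mul_eq_mul_div, ← add_div, div_eq_div_iff hb hnorm, ← hsq]
    ring

end CoordRing

/-! ### From the scheme to its function field -/

section Curve
universe u
variable {k : Type u} [Field k]

/-- The inclusion of the affine chart `y² = f(x)` into the projective curve. -/
def chartι (f : k[X]) : Spec (CommRingCat.of (CoordRing f)) ⟶ (curve f).left :=
  pushout.inl (toChart f) (toChartAtInfinity f)

/-- The inclusion of the chart at infinity `v² = u^(2g+2) f(1/u)` into the projective curve. -/
def chartInftyι (f : k[X]) : Spec (CommRingCat.of (CoordRing (reversed f))) ⟶ (curve f).left :=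
  pushout.inr (toChart f) (toChartAtInfinity f)

instance isOpenImmersion_chartι (f : k[X]) : IsOpenImmersion (chartι f) :=
  inferInstanceAs (IsOpenImmersion
    (colimit.ι (span (toChart f) (toChartAtInfinity f)) WalkingSpan.left))

instance isOpenImmersion_chartInftyι (f : k[X]) : IsOpenImmersion (chartInftyι f) :=
  inferInstanceAs (IsOpenImmersion
    (colimit.ι (span (toChart f) (toChartAtInfinity f)) WalkingSpan.right))

lemma chartι_comp_hom (f : k[X]) : chartι f ≫ (curve f).hom =
    Spec.map (CommRingCat.ofHom (algebraMap k (CoordRing f))) :=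
  pushout.inl_desc _ _ _

lemma toChart_comp_chartι (f : k[X]) :
    toChart f ≫ chartι f = toChartAtInfinity f ≫ chartInftyι f :=
  pushout.condition

lemma exists_chart (f : k[X]) (p : (curve f).left) :
    (∃ q, chartι f q = p) ∨ ∃ q, chartInftyι f q = p := by
  obtain ⟨i, q, hq⟩ := Scheme.IsLocallyDirected.ι_jointly_surjective
    (span (toChart f) (toChartAtInfinity f)) p
  match i, q, hq with
  | none, q, hq =>
    rw [← colimit.w (span (toChart f) (toChartAtInfinity f)) WalkingSpan.Hom.fst] at hq
    exact Or.inl ⟨toChart f q, hq⟩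
  | some WalkingPair.left, q, hq => exact Or.inl ⟨q, hq⟩
  | some WalkingPair.right, q, hq => exact Or.inr ⟨q, hq⟩

/-- Both charts are irreducible and their overlap is not empty, so they have the same generic point,
and it specializes to every point of the curve. -/
lemma irreducibleSpace_curve {f : k[X]} (hf : ¬ IsSquare f) : IrreducibleSpace (curve f).left := by
  have := isDomain_coordRing hf
  have := isDomain_coordRing (not_isSquare_reversed hf)
  have : IsDomain (AwayRing f) :=
    IsLocalization.isDomain_localization
      (powers_le_nonZeroDivisors_of_noZeroDivisors (xCoord_ne_zero f))
  have h1 := genericPoint_eq_of_isOpenImmersion (toChart f)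
  have h2 := genericPoint_eq_of_isOpenImmersion (toChartAtInfinity f)
  have h3 : chartι f (genericPoint _) = chartInftyι f (genericPoint _) := by
    rw [← h1, ← h2, ← Scheme.Hom.comp_apply, ← Scheme.Hom.comp_apply, toChart_comp_chartι]
  have h4 : closure {chartι f (genericPoint _)} = Set.univ := by
    refine Set.eq_univ_of_forall fun p => specializes_iff_mem_closure.1 ?_
    rcases exists_chart f p with ⟨q, rfl⟩ | ⟨q, rfl⟩
    · exact (genericPoint_specializes q).map (chartι f).continuous
    · rw [h3]
      exact (genericPoint_specializes q).map (chartInftyι f).continuous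
  rw [irreducibleSpace_def]
  change IsIrreducible Set.univ
  rw [← h4]
  exact isIrreducible_singleton.closure

/-- The function field of an irreducible scheme is the field of fractions of the coordinate ring of
any integral affine chart, compatibly with the canonical morphism from its spectrum. -/
lemma exists_toFunctionField {X : Scheme.{u}} [IrreducibleSpace X] {A : CommRingCat.{u}}
    [IsDomain A] (j : Spec A ⟶ X) [IsOpenImmersion j] :
    ∃ α : A ⟶ X.functionField, @IsFractionRing A _ X.functionField _ α.hom.toAlgebra ∧
      Spec.map α ≫ j = X.fromSpecStalk (genericPoint X) := by
  suffices ∀ p : X, j (genericPoint (Spec A)) = p → ∃ α : A ⟶ X.presheaf.stalk p,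
      @IsFractionRing A _ (X.presheaf.stalk p) _ α.hom.toAlgebra ∧
        Spec.map α ≫ j = X.fromSpecStalk p from
    this _ (genericPoint_eq_of_isOpenImmersion j)
  rintro _ rfl
  let τ : A ⟶ (Spec A).presheaf.stalk (genericPoint (Spec A)) := StructureSheaf.toStalk A _
  have hτ : (Spec A).fromSpecStalk (genericPoint (Spec A)) = Spec.map τ :=
    Spec.fromSpecStalk_eq' _ _
  refine ⟨τ ≫ inv (j.stalkMap (genericPoint (Spec A))), ?_, ?_⟩
  · have h := functionField_isFractionRing_of_affine A
    algebraize [(τ ≫ inv (j.stalkMap (genericPoint (Spec A)))).hom]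
    let e : (Spec A).functionField ≃ₐ[A] X.presheaf.stalk (j (genericPoint (Spec A))) :=
      AlgEquiv.ofRingEquiv
        (f := (asIso (j.stalkMap (genericPoint (Spec A)))).symm.commRingCatIsoToRingEquiv)
        fun a => by
          rfl
    exact IsLocalization.isLocalization_of_algEquiv _ e
  · rw [Spec.map_comp, Category.assoc, ← hτ,
      ← Scheme.SpecMap_stalkMap_fromSpecStalk, ← Category.assoc, ← Spec.map_comp]
    simp

/-- The function field of the curve `y² = f(x)` is a field of fractions of both coordinate rings, if
the curve is isomorphic to `y² = g(x)`. -/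
theorem exists_common_functionField {f g : k[X]} (hf : ¬ IsSquare f) (hg : ¬ IsSquare g)
    (e : curve f ≅ curve g) :
    ∃ (F : Type u) (_ : Field F) (_ : Algebra k F) (α : CoordRing f →ₐ[k] F)
      (β : CoordRing g →ₐ[k] F),
      (Function.Injective α ∧ ∀ z, ∃ a b, z = α a / α b) ∧
      (Function.Injective β ∧ ∀ z, ∃ a b, z = β a / β b) := by
  have := isDomain_coordRing hf
  have := isDomain_coordRing hg
  have := irreducibleSpace_curve hf
  let X := (curve f).left
  let e' : (curve g).left ≅ X := (Over.forget _).mapIso e.symm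
  obtain ⟨α, hα, hα'⟩ := exists_toFunctionField (chartι f)
  obtain ⟨β, hβ, hβ'⟩ := exists_toFunctionField (chartι g ≫ e'.hom)
  have hαβ : CommRingCat.ofHom (algebraMap k (CoordRing f)) ≫ α =
      CommRingCat.ofHom (algebraMap k (CoordRing g)) ≫ β := by
    apply Spec.map_injective
    rw [Spec.map_comp, Spec.map_comp, ← chartι_comp_hom, ← chartι_comp_hom, ← Category.assoc, hα',
      ← hβ', Category.assoc, Category.assoc]
    congr 2
    exact Over.w e.inv
  let F : Type u := X.functionField
  let _ : Algebra (CoordRing f) F := α.hom.toAlgebra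
  have : IsFractionRing (CoordRing f) F := hα
  let _ : Field F := IsFractionRing.toField (CoordRing f)
  let _ : Algebra (CoordRing g) F := β.hom.toAlgebra
  have : IsFractionRing (CoordRing g) F := hβ
  let _ : Algebra k F := (α.hom.comp (algebraMap k (CoordRing f))).toAlgebra
  refine ⟨F, inferInstance, inferInstance, ⟨α.hom, fun _ => rfl⟩, ⟨β.hom, fun r => ?_⟩,
    ⟨IsFractionRing.injective (CoordRing f) F, fun z => ?_⟩,
    ⟨IsFractionRing.injective (CoordRing g) F, fun z => ?_⟩⟩
  · exact (congrArg (fun φ => φ.hom r) hαβ).symm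
  · obtain ⟨a, b, -, h⟩ := IsFractionRing.div_surjective (CoordRing f) z
    exact ⟨a, b, h.symm⟩
  · obtain ⟨a, b, -, h⟩ := IsFractionRing.div_surjective (CoordRing g) z
    exact ⟨a, b, h.symm⟩

open Classical in
/-- An isomorphism of hyperelliptic curves induces a Möbius transformation that carries branch
points to branch points. -/
theorem exists_moebius_of_iso {f g : k[X]} (h2 : (2 : k) ≠ 0) (hf : Squarefree f)
    (hg : Squarefree g) (hdeg : 5 ≤ f.natDegree) (hfg : f.natDegree = g.natDegree)
    (e : curve f ≅ curve g) : ∃ γ : GL (Fin 2) k, ∀ p ∈ branchSet (2 * halfDegree f) f,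
      γ • p ∈ branchSet (2 * halfDegree f) g := by
  obtain ⟨F, _, _, α, β, ⟨hα, hα'⟩, hβ, hβ'⟩ := exists_common_functionField
    (not_isSquare_of_squarefree hf (by omega)) (not_isSquare_of_squarefree hg (by omega)) e
  obtain ⟨a, b, c, d, κ, hdet, h⟩ :=
    (isQuadraticPair_of_isFractionRing α hα hα').exists_homogSubst_eq (m := halfDegree f)
      (isQuadraticPair_of_isFractionRing β hβ hβ') h2 hf hdeg
      (by unfold halfDegree; omega) (hfg ▸ natDegree_le f)
  exact exists_smul_mem_branchSet (hfg ▸ natDegree_le f) hdet h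

end Curve

end Hyperelliptic

end

open Polynomial Hyperelliptic

theorem mainTheorem12 {K : Type*} [Field K] (hchar : (2 : K) ≠ 0)
    (n : ℕ) (hn : 7 ≤ n) (h : K[X]) (hirr : Irreducible h) (hdeg : h.natDegree = n - 1)
    (hgal : Nonempty (h.Gal ≃* Equiv.Perm (Fin (n - 1))) ∨
      Nonempty (h.Gal ≃* alternatingGroup (Fin (n - 1)))) :
    ∃ B : Set K, B.Finite ∧ ∀ t₁ t₂ : K, t₁ ≠ t₂ →
      Hyperelliptic.IsomorphicOverClosure
        ((Polynomial.X - Polynomial.C t₁) * h) ((Polynomial.X - Polynomial.C t₂) * h) →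
      t₁ ∈ B ∧ t₂ ∈ B := by
  classical
  have hcard := factorial_le_two_mul_card_gal (by omega) hgal
  have hsep := separable_of_card_gal (by omega) hdeg hcard
  set L := AlgebraicClosure K
  have : Fact ((h.map (algebraMap K L)).Splits) := ⟨IsAlgClosed.splits _⟩
  have hmem (b : L) : b ∈ h.rootSet L ↔ aeval b h = 0 :=
    (mem_rootSet.trans (and_iff_right hirr.ne_zero))
  have hev := eval_ne_zero_of_irreducible hirr (by omega)
  -- The branch points common to all the curves: the roots of `h`, and `∞` if `n` is odd.
  let R₀ : Finset (OnePoint L) := (h.rootSet L).toFinset.map ⟨(↑), OnePoint.coe_injective⟩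
  let R : Finset (OnePoint L) := if Odd n then insert OnePoint.infty R₀ else R₀
  have hcoe (b : L) : (b : OnePoint L) ∈ R ↔ b ∈ h.rootSet L := by
    by_cases hodd : Odd n <;> simp [R, R₀, hodd]
  have hinfty : OnePoint.infty ∈ R ↔ Odd n := by
    by_cases hodd : Odd n <;> simp [R, R₀, hodd]
  have hRcard : 7 ≤ R.card := by
    have h0 : R₀.card = n - 1 := by
      rw [Finset.card_map, Set.toFinset_card, card_rootSet_eq (by omega) hdeg hcard]
    by_cases hodd : Odd n
    · have h1 : OnePoint.infty ∉ R₀ := by simp [R₀]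
      simp only [R, if_pos hodd]
      rw [Finset.card_insert_of_notMem h1]
      omega
    · have : n ≠ 7 := by
        rintro rfl
        exact hodd (by decide)
      simp only [R, if_neg hodd]
      omega
  have hT (t : K) : ((algebraMap K L t : L) : OnePoint L) ∉ R := by
    rw [hcoe, hmem, aeval_algebraMap_apply]
    simpa using hev t
  have hdeg' (t : K) : ((X - C t) * h).natDegree = n := by
    rw [natDegree_mul (X_sub_C_ne_zero t) hirr.ne_zero, natDegree_X_sub_C, hdeg]
    omega
  have hbranch (t : K) (p : OnePoint L) :
      p ∈ branchSet (2 * ((n + 1) / 2)) (((X - C t) * h).map (algebraMap K L)) ↔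
        p ∈ insert ((algebraMap K L t : L) : OnePoint L) R := by
    rw [Finset.mem_insert]
    cases p with
    | infty =>
      have h1 := hdeg' t
      rw [infty_mem_branchSet, hinfty, coeff_map, map_eq_zero]
      simp only [OnePoint.infty_ne_coe, false_or]
      rcases Nat.even_or_odd n with hn' | hn'
      · have : 2 * ((n + 1) / 2) = ((X - C t) * h).natDegree := by
          rw [h1]
          obtain ⟨r, rfl⟩ := hn'
          omega
        rw [this, coeff_natDegree, leadingCoeff_eq_zero]
        simp [X_sub_C_ne_zero, hirr.ne_zero, hn']
      · refine iff_of_true (coeff_eq_zero_of_natDegree_lt ?_) hn'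
        rw [h1]
        obtain ⟨r, rfl⟩ := hn'
        omega
    | coe b =>
      rw [coe_mem_branchSet, hcoe, hmem, OnePoint.coe_eq_coe, eval_map_algebraMap, map_mul,
        mul_eq_zero]
      simp [sub_eq_zero]
  have key (t₁ t₂ : K) (hne : t₁ ≠ t₂) (hiso : IsomorphicOverClosure ((X - C t₁) * h)
      ((X - C t₂) * h)) : ((algebraMap K L t₁ : L) : OnePoint L) ∈ exceptionalPoints R := by
    obtain ⟨e⟩ := hiso
    have hsqf (t : K) : Squarefree (((X - C t) * h).map (algebraMap K L)) :=
      (separable_X_sub_C_mul hsep (hev t)).map.squarefree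
    have hd (t : K) : (((X - C t) * h).map (algebraMap K L)).natDegree = n := by
      rw [natDegree_map, hdeg']
    obtain ⟨γ, hγ⟩ := exists_moebius_of_iso
      (by rw [← map_ofNat (algebraMap K L) 2]; exact (_root_.map_ne_zero _).2 hchar)
      (hsqf t₁) (hsqf t₂) (by rw [hd]; omega) (by rw [hd, hd]) e
    rw [halfDegree, hd] at hγ
    refine mem_exceptionalPoints (K := K) hRcard ?_ ?_ hne (hT t₁) (γ := γ) ?_
    · intro σ p hp
      cases p with
      | infty => exact hp
      | coe b =>
        rw [OnePoint.map_some, hcoe, hmem] at *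
        rw [← AlgEquiv.coe_toAlgHom, aeval_algHom_apply, hp, map_zero]
    · intro a b ha hb hab
      exact exists_gal_fix_move (by omega) hdeg hcard ((hcoe a).1 ha) ((hcoe b).1 hb) hab
    · intro p hp
      exact (hbranch t₂ _).1 (hγ p ((hbranch t₁ p).2 hp))
  refine ⟨(fun t : K => ((algebraMap K L t : L) : OnePoint L)) ⁻¹' exceptionalPoints R,
    (finite_exceptionalPoints R).preimage
      (OnePoint.coe_injective.comp (algebraMap K L).injective).injOn, ?_⟩
  intro t₁ t₂ hne hiso
  exact ⟨key t₁ t₂ hne hiso, key t₂ t₁ hne.symm (hiso.map Iso.symm)⟩
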